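/- Let $\mathbf{Set}$ be the category of sets, $\mathbf{Set}_{\mathsf f}$ its full subcategory of finite sets with inclusion $I\colon \mathbf{Set}_{\mathsf f}\hookrightarrow\mathbf{Set}$, and $\mathbf{BA}$ the category of Boolean algebras; write $2=\{0,1\}$ for the two-element set and for the two-element Boolean algebra. The *ultrafilter monad* $\mathcal U$ on $\mathbf{Set}$ is the monad induced by the dual adjunction $$\mathbf{Set}(-,2)\dashv \mathbf{BA}(-,2)\colon \mathbf{BA}^{\mathsf{op}}\to\mathbf{Set},$$ where $\mathbf{Set}(X,2)$ carries the pointwise Boolean algebra structure and the unit and counit are given by evaluation; thus $\mathcal U X=\mathbf{BA}(\mathbf{Set}(X,2),2)$. The *codensity monad* of a functor $F\colon\mathbf A\to\mathbf C$ is the monad $(\mathrm{Ran}_F F,\eta,\mu)$ carried by the right Kan extension of $F$ along itself (if it exists), with counit $\varphi\colon(\mathrm{Ran}_FF)F\to F$, where $\eta\colon\mathrm{Id}\to\mathrm{Ran}_FF$ and $\mu\colon(\mathrm{Ran}_FF)(\mathrm{Ran}_FF)\to\mathrm{Ran}_FF$ are the unique natural transformations with $\varphi\cdot\eta F=\mathrm{id}_F$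 and $\varphi\cdot\mu F=\varphi\cdot(\mathrm{Ran}_FF)\varphi$. **Theorem (Kennison–Gildenhuys).** The ultrafilter monad $\mathcal U$ on $\mathbf{Set}$ is the codensity monad of the inclusion $I\colon\mathbf{Set}_{\mathsf f}\hookrightarrow\mathbf{Set}$. That is, the right Kan extension $\mathrm{Ran}_I I$ exists and is pointwise, i.e. $(\mathrm{Ran}_I I)X=\lim_{f\colon X\to IA}IA$ for every set $X$, with $f$ ranging over all maps from $X$ to finite sets $A$, and $\mathcal U$ is isomorphic, in the category of monads on $\mathbf{Set}$ and monad morphisms, to the codensity monad of $I$. -/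

import Mathlib

open CategoryTheory Opposite

universe u

namespace Codensity

noncomputable section General

universe v₁ v₂ u₁ u₂

variable {A : Type u₁} [Category.{v₁} A] {C : Type u₂} [Category.{v₂} C] (F : A ⥤ C)
  [F.HasRightKanExtension F]

/-- The underlying endofunctor `Ran_F F`. -/
abbrev ran : C ⥤ C := F.rightKanExtension F

/-- The counit `φ : (Ran_F F) F ⟶ F`. -/
abbrev counit : F ⋙ ran F ⟶ F := F.rightKanExtensionCounit F

/-- The unit: the transformation corresponding to `id : F ⟶ F`. -/
def unit : 𝟭 C ⟶ ran F :=
  (ran F).liftOfIsRightKanExtension (counit F) (𝟭 C) F.rightUnitor.hom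

/-- The multiplication: the transformation corresponding to
`(Ran_F F)(Ran_F F) F ⟶ (Ran_F F) F ⟶ F`, the composite of `(Ran_F F) φ` and `φ`. -/
def mult : ran F ⋙ ran F ⟶ ran F :=
  (ran F).liftOfIsRightKanExtension (counit F) (ran F ⋙ ran F)
    ((Functor.associator F (ran F) (ran F)).inv ≫
      Functor.whiskerRight (counit F) (ran F) ≫ counit F)

theorem unit_fac (X : A) : (unit F).app (F.obj X) ≫ (counit F).app X = 𝟙 (F.obj X) := by
  simp [unit]

theorem mult_fac (X : A) : (mult F).app (F.obj X) ≫ (counit F).app X =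
    (ran F).map ((counit F).app X) ≫ (counit F).app X := by
  simp [mult]

theorem ran_hom_ext {G : C ⥤ C} {γ₁ γ₂ : G ⟶ ran F}
    (h : ∀ X : A, γ₁.app (F.obj X) ≫ (counit F).app X = γ₂.app (F.obj X) ≫ (counit F).app X) :
    γ₁ = γ₂ :=
  (ran F).hom_ext_of_isRightKanExtension (counit F) _ _ (by ext X; exact h X)

theorem unit_mult (X : C) : (unit F).app ((ran F).obj X) ≫ (mult F).app X = 𝟙 _ := by
  have h : (Functor.rightUnitor (ran F)).inv ≫ Functor.whiskerLeft (ran F) (unit F) ≫ mult F =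
      𝟙 (ran F) := by
    refine ran_hom_ext F fun Y => ?_
    have := (unit F).naturality ((counit F).app Y)
    simp only [Functor.id_obj, Functor.id_map] at this
    simp only [NatTrans.comp_app, Functor.rightUnitor_inv_app, Functor.whiskerLeft_app,
      Category.assoc, mult_fac, NatTrans.id_app, Category.id_comp]
    erw [← reassoc_of% this, unit_fac, Category.comp_id]
  simpa using NatTrans.congr_app h X

theorem map_unit_mult (X : C) : (ran F).map ((unit F).app X) ≫ (mult F).app X = 𝟙 _ := by
  have h : (Functor.leftUnitor (ran F)).inv ≫ Functor.whiskerRight (unit F) (ran F) ≫ mult F =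
      𝟙 (ran F) := by
    refine ran_hom_ext F fun Y => ?_
    simp only [NatTrans.comp_app, Functor.leftUnitor_inv_app, Functor.whiskerRight_app,
      Category.assoc, mult_fac, NatTrans.id_app, Category.id_comp]
    rw [← Functor.map_comp_assoc, unit_fac]
    simp
  simpa using NatTrans.congr_app h X

theorem mult_assoc (X : C) : (ran F).map ((mult F).app X) ≫ (mult F).app X =
    (mult F).app ((ran F).obj X) ≫ (mult F).app X := by
  have h : Functor.whiskerRight (mult F) (ran F) ≫ mult F =
      (Functor.associator (ran F) (ran F) (ran F)).hom ≫
        Functor.whiskerLeft (ran F) (mult F) ≫ mult F := by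
    refine ran_hom_ext F fun Y => ?_
    have := (mult F).naturality ((counit F).app Y)
    simp only [Functor.comp_map] at this
    simp only [NatTrans.comp_app, Functor.associator_hom_app, Functor.whiskerRight_app,
      Functor.whiskerLeft_app, Category.assoc, mult_fac, Category.id_comp]
    erw [← reassoc_of% this, ← Functor.map_comp_assoc, mult_fac]
    simp
  simpa using NatTrans.congr_app h X

/-- The codensity monad of `F : A ⥤ C`, defined when the right Kan extension of `F` along itself
exists. -/
def codensityMonad : Monad C where
  toFunctor := ran F
  η := unit F
  μ := mult F
  assoc := mult_assoc F
  left_unit := unit_mult F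
  right_unit := map_unit_mult F

end General

noncomputable section Ultrafilter

/-- The functor `Set(-,2) : Set ⥤ BAᵒᵖ`, where `Set(X,2)` has the pointwise operations. -/
def predicates : Type u ⥤ BoolAlg.{u}ᵒᵖ where
  obj X := op (BoolAlg.of (X → Bool))
  map {X Y} f := Quiver.Hom.op (BoolAlg.ofHom
    { toFun := fun p x => p (f x)
      map_sup' := fun _ _ => rfl
      map_inf' := fun _ _ => rfl
      map_top' := rfl
      map_bot' := rfl } : BoolAlg.of (Y → Bool) ⟶ BoolAlg.of (X → Bool))

/-- The functor `BA(-,2) : BAᵒᵖ ⥤ Set`. The morphisms of the category of Boolean algebras are the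
maps preserving `⊔`, `⊓`, `⊤`, `⊥` (hence complements), that is, `BoundedLatticeHom`. -/
def points : BoolAlg.{u}ᵒᵖ ⥤ Type u where
  obj B := BoundedLatticeHom B.unop Bool
  map f := ↾fun χ => χ.comp f.unop.hom

/-- Evaluation `X → BA(Set(X,2),2)` at points of `X`. -/
def evalPoint (X : Type u) (x : X) : BoundedLatticeHom (X → Bool) Bool where
  toFun p := p x
  map_sup' _ _ := rfl
  map_inf' _ _ := rfl
  map_top' := rfl
  map_bot' := rfl

/-- Evaluation `B → Set(BA(B,2),2)` at elements of the Boolean algebra `B`. -/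
def evalElement (B : BoolAlg.{u}) : BoundedLatticeHom B (BoundedLatticeHom B Bool → Bool) where
  toFun b χ := χ b
  map_sup' _ _ := funext fun χ => map_sup χ _ _
  map_inf' _ _ := funext fun χ => map_inf χ _ _
  map_top' := funext fun χ => map_top χ
  map_bot' := funext fun χ => map_bot χ

/-- The dual adjunction `Set(-,2) ⊣ BA(-,2) : BAᵒᵖ ⥤ Set`. -/
def dualAdjunction : predicates.{u} ⊣ points.{u} :=
  Adjunction.mkOfUnitCounit
    { unit := { app := fun X => ↾(evalPoint X)
                naturality := fun _ _ _ => rfl }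
      counit := { app := fun B => Quiver.Hom.op (BoolAlg.ofHom (evalElement B.unop))
                  naturality := fun _ _ _ => rfl }
      left_triangle := rfl
      right_triangle := rfl }

/-- The ultrafilter monad on `Set`, `X ↦ BA(Set(X,2),2)`, induced by the dual adjunction. -/
def ultrafilterMonad : Monad (Type u) := dualAdjunction.{u}.toMonad

end Ultrafilter

end Codensity

namespace Codensity

noncomputable section Recognition

universe v₁ v₂ u₁ u₂

variable {A : Type u₁} [Category.{v₁} A] {C : Type u₂} [Category.{v₂} C] {F : A ⥤ C}
  [F.HasRightKanExtension F]

/-! An ultrafilter on `X` pushed forward along a map to a finite set is principal, so it picks a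
point of that set; these points form a cone. Conversely, the components of any cone at two-valued
maps define a function on predicates (`ultrafilterOfCone`). It is a homomorphism because finitely
many predicates factor through one map to a finite set, where the cone evaluates them at a single
point. For the monad structures, universality reduces agreement of units and multiplications to two
equations after the counit, checked on finite sets only. -/

/-- A monad `T` whose underlying functor is a right Kan extension of `F` along itself, with a
counit compatible with the unit and the multiplication of `T`, is isomorphic to the codensity
monad of `F`. -/
def isoCodensityMonad (T : Monad C) (α : F ⋙ (T : C ⥤ C) ⟶ F)
    [(T : C ⥤ C).IsRightKanExtension α]
    (hη : ∀ X, T.η.app (F.obj X) ≫ α.app X = 𝟙 (F.obj X))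
    (hμ : ∀ X, T.μ.app (F.obj X) ≫ α.app X = T.map (α.app X) ≫ α.app X) :
    T ≅ codensityMonad F := by
  let e : (T : C ⥤ C) ≅ ran F :=
    Functor.rightKanExtensionUnique (T : C ⥤ C) α (ran F) (counit F)
  have he (X : A) : e.hom.app (F.obj X) ≫ (counit F).app X = α.app X := by
    simp [e]
  have h_unit : T.η ≫ e.hom = unit F := by
    refine ran_hom_ext F fun X => ?_
    rw [NatTrans.comp_app, Category.assoc, he, hη, unit_fac]
  have h_mult : T.μ ≫ e.hom = Functor.whiskerRight e.hom (T : C ⥤ C) ≫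
      Functor.whiskerLeft (ran F) e.hom ≫ mult F := by
    refine ran_hom_ext F fun X => ?_
    -- Sliding `e` past the counit lets `he` turn both copies of `e` into `α`.
    have hn : T.map ((counit F).app X) ≫ e.hom.app (F.obj X) =
        e.hom.app ((ran F).obj (F.obj X)) ≫ (ran F).map ((counit F).app X) :=
      e.hom.naturality ((counit F).app X)
    simp only [NatTrans.comp_app, Category.assoc, he, hμ, mult_fac, Functor.whiskerRight_app,
      Functor.whiskerLeft_app]
    rw [← reassoc_of% hn, he, ← Functor.map_comp_assoc, he]
  refine MonadIso.mk (N := codensityMonad F) e (fun X => NatTrans.congr_app h_unit X)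
    fun X => ?_
  have := NatTrans.congr_app h_mult X
  simp only [NatTrans.comp_app, Functor.whiskerRight_app, Functor.whiskerLeft_app] at this
  rw [Category.assoc]
  exact this

end Recognition

noncomputable section FiniteSets

/-- On a finite set every ultrafilter is principal. -/
theorem exists_eq_evalPoint {A : Type u} [Finite A] (χ : BoundedLatticeHom (A → Bool) Bool) :
    ∃ a, χ = evalPoint A a := by
  classical
  have := Fintype.ofFinite A
  let δ (a : A) : A → Bool := fun b => decide (b = a)
  have h_sup : Finset.univ.sup δ = ⊤ := by
    rw [eq_top_iff]
    intro b _
    have h : δ b b ≤ Finset.univ.sup δ b := Finset.le_sup (f := δ) (Finset.mem_univ b) b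
    exact h (decide_eq_true rfl)
  -- The singletons have join `⊤`, so `χ` must hold on one of them.
  have h_true : Finset.univ.sup (fun a => χ (δ a)) = ⊤ := by
    rw [← map_top χ, ← h_sup, map_finset_sup]
    rfl
  obtain ⟨a, ha⟩ : ∃ a, χ (δ a) = true := by
    by_contra! h
    have : (fun a => χ (δ a)) = fun _ => ⊥ := funext fun a => by simpa using h a
    rw [this, Finset.sup_bot] at h_true
    exact absurd h_true (by decide)
  refine ⟨a, DFunLike.ext _ _ fun p => ?_⟩
  have h_inf : χ (p ⊓ δ a) = χ p ⊓ χ (δ a) := map_inf χ p (δ a)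
  rw [ha] at h_inf
  -- `δ a` is an atom, so `p a` alone decides `χ p`.
  have h_meet : p ⊓ δ a = if p a then δ a else ⊥ := by
    funext b
    by_cases hb : b = a
    · subst hb
      cases hp : p b <;> simp [δ, hp]
    · cases hp : p a <;> simp [δ, hb]
  change χ p = p a
  rw [h_meet] at h_inf
  cases hp : p a <;> simp_all

/-- The point of a finite set at which an ultrafilter on it is concentrated. -/
def concentration {A : Type u} [Finite A] (χ : BoundedLatticeHom (A → Bool) Bool) : A :=
  (exists_eq_evalPoint χ).choose

theorem apply_concentration {A : Type u} [Finite A] (χ : BoundedLatticeHom (A → Bool) Bool)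
    (p : A → Bool) : p (concentration χ) = χ p :=
  (DFunLike.congr_fun (exists_eq_evalPoint χ).choose_spec p).symm

theorem eq_of_forall_bool {A : Type u} {a b : A} (h : ∀ p : A → Bool, p a = p b) : a = b := by
  classical
  simpa using h fun x => decide (x = b)

theorem concentration_eq {A : Type u} [Finite A] {χ : BoundedLatticeHom (A → Bool) Bool} {a : A}
    (h : ∀ p, χ p = p a) : concentration χ = a :=
  eq_of_forall_bool fun p => (apply_concentration χ p).trans (h p)

/-- The natural transformation with components the inverses of the evaluations `A → 𝒰 A`,
for finite sets `A`. -/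
def ultrafilterCounit :
    FintypeCat.incl.{u} ⋙ (ultrafilterMonad.{u} : Type u ⥤ Type u) ⟶ FintypeCat.incl.{u} where
  app A := ↾fun χ : BoundedLatticeHom (A.obj → Bool) Bool => concentration (A := A.obj) χ
  naturality A B f := by
    ext (χ : BoundedLatticeHom (A.obj → Bool) Bool)
    exact concentration_eq (A := B.obj) (χ := points.map (predicates.map f.hom) χ)
      (a := f (concentration χ)) fun p => (apply_concentration χ fun x => p (f x)).symm

/-- The ultrafilter determined by an element of a cone over the maps to finite sets. -/
def ultrafilterOfCone {X : Type u}
    (s : Limits.Cone (StructuredArrow.proj X FintypeCat.incl.{u} ⋙ FintypeCat.incl.{u}))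
    (x : s.pt) (p : X → Bool) : Bool :=
  (s.π.app (StructuredArrow.mk (Y := FintypeCat.of (ULift.{u} Bool))
    (↾fun y => ULift.up (p y))) x : ULift.{u} Bool).down

/-- Cone compatibility along `p`, seen as a morphism from `g` to `p ∘ g` under `X`. -/
theorem ultrafilterOfCone_comp {X : Type u}
    (s : Limits.Cone (StructuredArrow.proj X FintypeCat.incl.{u} ⋙ FintypeCat.incl.{u}))
    (x : s.pt) (g : StructuredArrow X FintypeCat.incl.{u}) (p : g.right.obj → Bool) :
    ultrafilterOfCone s x (fun y => p (g.hom y)) = p (s.π.app g x) := by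
  have h := s.w (StructuredArrow.homMk (FintypeCat.homMk fun a => ULift.up (p a)) rfl :
    g ⟶ StructuredArrow.mk (Y := FintypeCat.of (ULift.{u} Bool))
      (↾fun y => ULift.up (p (g.hom y))))
  exact congrArg ULift.down (ConcreteCategory.congr_hom h x).symm

theorem ultrafilterOfCone_comp_mk {X : Type u}
    (s : Limits.Cone (StructuredArrow.proj X FintypeCat.incl.{u} ⋙ FintypeCat.incl.{u}))
    (x : s.pt) {A : Type u} [Finite A] (g : X → A) :
    ∃ a : A, ∀ p : A → Bool, ultrafilterOfCone s x (fun y => p (g y)) = p a :=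
  ⟨_, ultrafilterOfCone_comp s x (StructuredArrow.mk (Y := FintypeCat.of A) (↾g))⟩

/-- `ultrafilterOfCone` as a homomorphism of Boolean algebras. -/
def ultrafilterOfConeHom {X : Type u}
    (s : Limits.Cone (StructuredArrow.proj X FintypeCat.incl.{u} ⋙ FintypeCat.incl.{u}))
    (x : s.pt) : BoundedLatticeHom (X → Bool) Bool where
  toFun := ultrafilterOfCone s x
  map_sup' p q := by
    -- `p`, `q` and their join all factor through the pairing into `Bool × Bool`.
    obtain ⟨a, ha⟩ := ultrafilterOfCone_comp_mk s x fun y => ULift.up.{u} (p y, q y)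
    have h₁ := ha fun t => t.down.1
    have h₂ := ha fun t => t.down.2
    have h := ha fun t => t.down.1 ⊔ t.down.2
    exact h.trans (congrArg₂ (· ⊔ ·) h₁ h₂).symm
  map_inf' p q := by
    obtain ⟨a, ha⟩ := ultrafilterOfCone_comp_mk s x fun y => ULift.up.{u} (p y, q y)
    have h₁ := ha fun t => t.down.1
    have h₂ := ha fun t => t.down.2
    have h := ha fun t => t.down.1 ⊓ t.down.2
    exact h.trans (congrArg₂ (· ⊓ ·) h₁ h₂).symm
  map_top' := by
    -- Constant predicates factor through a point.
    obtain ⟨a, ha⟩ := ultrafilterOfCone_comp_mk s x fun _ => PUnit.unit.{u + 1}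
    exact ha fun _ => ⊤
  map_bot' := by
    obtain ⟨a, ha⟩ := ultrafilterOfCone_comp_mk s x fun _ => PUnit.unit.{u + 1}
    exact ha fun _ => ⊥

/-- The set of ultrafilters on `X` is the limit of the finite sets `A` over all maps `X → A`. -/
def isPointwiseRightKanExtension_ultrafilterMonad :
    (Functor.RightExtension.mk (ultrafilterMonad.{u} : Type u ⥤ Type u)
      ultrafilterCounit.{u}).IsPointwiseRightKanExtension := fun X =>
  { lift := fun s => ↾(ultrafilterOfConeHom s)
    fac := fun s g => by
      ext x
      exact concentration_eq (A := g.right.obj) (a := s.π.app g x)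
        (χ := points.map (predicates.map g.hom) (ultrafilterOfConeHom s x))
        (ultrafilterOfCone_comp s x g)
    uniq := fun s m hm => by
      ext x
      refine DFunLike.ext (F := BoundedLatticeHom (X → Bool) Bool) _ _ fun p => ?_
      -- The component at `p` itself recovers the value of `m x` at `p`.
      let g : StructuredArrow X FintypeCat.incl.{u} :=
        StructuredArrow.mk (Y := FintypeCat.of (ULift.{u} Bool)) (↾fun y => ULift.up (p y))
      have h := ConcreteCategory.congr_hom (hm g) x
      exact (apply_concentration (A := ULift.{u} Bool)
        (points.map (predicates.map g.hom) (m x)) ULift.down).symm.trans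
        (congrArg ULift.down h) }

theorem ultrafilterMonad_η_counit (A : FintypeCat.{u}) :
    ultrafilterMonad.{u}.η.app (FintypeCat.incl.obj A) ≫ ultrafilterCounit.app A =
      𝟙 (FintypeCat.incl.obj A) := by
  ext a
  exact concentration_eq (A := A.obj) (χ := evalPoint A.obj a) (a := a) fun _ => rfl

theorem ultrafilterMonad_μ_counit (A : FintypeCat.{u}) :
    ultrafilterMonad.{u}.μ.app (FintypeCat.incl.obj A) ≫ ultrafilterCounit.app A =
      ultrafilterMonad.{u}.map (ultrafilterCounit.app A) ≫ ultrafilterCounit.app A := by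
  ext (Φ : BoundedLatticeHom (BoundedLatticeHom (A.obj → Bool) Bool → Bool) Bool)
  let Ψ : BoundedLatticeHom (A.obj → Bool) Bool :=
    points.map (predicates.map (ultrafilterCounit.app A)) Φ
  refine concentration_eq (A := A.obj) (χ := ultrafilterMonad.{u}.μ.app A.obj Φ)
    (a := concentration Ψ) fun p => ?_
  refine Eq.trans ?_ (apply_concentration Ψ p).symm
  -- Evaluation at `p` on ultrafilters is `p ∘ concentration`.
  exact congrArg Φ (funext fun χ : BoundedLatticeHom (A.obj → Bool) Bool =>
    (apply_concentration χ p).symm)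

end FiniteSets

end Codensity

theorem theorem4p1 :
    ∃ _ : FintypeCat.incl.{u}.HasRightKanExtension FintypeCat.incl.{u},
      Nonempty (Functor.RightExtension.mk
        (FintypeCat.incl.{u}.rightKanExtension FintypeCat.incl.{u})
        (FintypeCat.incl.{u}.rightKanExtensionCounit
          FintypeCat.incl.{u})).IsPointwiseRightKanExtension ∧
      Nonempty (Codensity.ultrafilterMonad.{u} ≅
        Codensity.codensityMonad FintypeCat.incl.{u}) := by
  have h := Codensity.isPointwiseRightKanExtension_ultrafilterMonad.{u}
  have h_ran : (Codensity.ultrafilterMonad.{u} : Type u ⥤ Type u).IsRightKanExtension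
      Codensity.ultrafilterCounit.{u} := h.isRightKanExtension
  -- Pointwiseness passes to the chosen extension.
  have := h.hasPointwiseRightKanExtension
  exact ⟨h.hasRightKanExtension,
    ⟨Functor.isPointwiseRightKanExtensionOfIsRightKanExtension _ _⟩,
    ⟨Codensity.isoCodensityMonad _ Codensity.ultrafilterCounit
      Codensity.ultrafilterMonad_η_counit Codensity.ultrafilterMonad_μ_counit⟩⟩
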